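/- Let $\alpha>0$ and $0<R<\rho$. Let $I_n$ and $K_n$ denote the modified Bessel functions of the first and second kind of order $n$. For integers $n\ge 0$ put $A_n=(1+n)K_{n+1}(\alpha\rho)I_{n+1}(\alpha R)$, and for $\theta\in\mathbb{R}$ put $$d(\theta)=|R-\rho e^{-i\theta}|,\qquad c(\theta)=-\alpha K_1(\alpha d(\theta))\,\frac{R-\rho\cos\theta}{d(\theta)}.$$ For every $n\in\mathbb{Z}$ the series $$\tilde A_n=\sum_{r=0}^{\infty}\Big(A_{|n-1|+2r}+A_{|n+1|+2r}-\frac{2R}{\rho}A_{|n|+2r}\Big)$$ converges, and the Fourier series expansion of $c$ is $$c(\theta)=\frac1R\sum_{n\in\mathbb{Z}}\tilde A_n e^{in\theta}\qquad(\theta\in\mathbb{R}),$$ that is, $\tilde A_n/R=\frac1{2\pi}\int_0^{2\pi}c(\theta)e^{-in\theta}\,d\theta$ for all $n\in\mathbb{Z}$, and the series converges absolutely to $c(\theta)$ for every $\theta$. Moreover, let $N\ge 1$, $\omega=e^{2\pi i/N}$, $x_j=R\omega^j$, $y_k=\rho\omega^k$, and let $G=(c_{k,j})_{1\le k,j\le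 N}$ be the (cyclic) matrix with entries $$c_{k,j}=-\alpha K_1(\alpha|x_j-y_k|)\,\frac{|x_j|-\operatorname{Re}\big((x_j/|x_j|)\,\overline{y_k}\big)}{|x_j-y_k|}$$ (the outward normal derivative of $x\mapsto K_0(\alpha|x-y_k|)$ on the circle $|x|=R$ at $x_j$). Put $f(x)=\sum_{l=0}^{N-1}c(2\pi l/N)\,x^l$. Then the eigenvalues of $G$, counted with algebraic multiplicity, are $f(\omega^m)$, $m=0,\dots,N-1$, and $$f(\omega^m)=\frac NR\sum_{n\in\mathbb{Z},\ N\mid n+m}\tilde A_n=\frac NR\sum_{n\in\mathbb{Z}}\tilde A_{nN+m}\qquad(m=0,\dots,N-1),$$ both series being absolutely convergent. -/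

import Mathlib

namespace MFS

noncomputable section

/-- Modified Bessel function of the first kind of order `n`,
`I_n(x) = ∑ₖ (x/2)^(2k+n) / (k! (n+k)!)`. -/
def besselI (n : ℕ) (x : ℝ) : ℝ :=
  ∑' k : ℕ, (x / 2) ^ (2 * k + n) / ((Nat.factorial k : ℝ) * (Nat.factorial (n + k) : ℝ))

/-- Modified Bessel function of the second kind of order `n`, for `x > 0`,
`K_n(x) = ∫₀^∞ exp(-x cosh t) cosh(n t) dt`. -/
def besselK (n : ℕ) (x : ℝ) : ℝ :=
  ∫ t in Set.Ioi (0 : ℝ), Real.exp (-x * Real.cosh t) * Real.cosh (n * t)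

/-- `A_n = (1 + n) K_{n+1}(α ρ) I_{n+1}(α R)`. -/
def coeffA (α R ρ : ℝ) (n : ℕ) : ℝ :=
  (1 + (n : ℝ)) * besselK (n + 1) (α * ρ) * besselI (n + 1) (α * R)

/-- The `r`-th term of the series defining `Ã_n`. -/
def tildeTerm (α R ρ : ℝ) (n : ℤ) (r : ℕ) : ℝ :=
  coeffA α R ρ ((n - 1).natAbs + 2 * r) + coeffA α R ρ ((n + 1).natAbs + 2 * r)
    - 2 * R / ρ * coeffA α R ρ (n.natAbs + 2 * r)

/-- `Ã_n = ∑_{r ≥ 0} (A_{|n-1|+2r} + A_{|n+1|+2r} - (2R/ρ) A_{|n|+2r})`. -/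
def tildeA (α R ρ : ℝ) (n : ℤ) : ℝ :=
  ∑' r : ℕ, tildeTerm α R ρ n r

/-- `d(θ) = |R - ρ e^{-iθ}|`. -/
def pointDist (R ρ θ : ℝ) : ℝ :=
  ‖(R : ℂ) - (ρ : ℂ) * Complex.exp (-(Complex.I * (θ : ℂ)))‖

/-- `c(θ) = -α K₁(α d(θ)) (R - ρ cos θ) / d(θ)`. -/
def kernel (α R ρ θ : ℝ) : ℝ :=
  -α * besselK 1 (α * pointDist R ρ θ) * ((R - ρ * Real.cos θ) / pointDist R ρ θ)

/-- `ω = e^{2πi/N}`. -/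
def omega (N : ℕ) : ℂ :=
  Complex.exp (2 * (Real.pi : ℂ) * Complex.I / (N : ℂ))

/-- The collocation points `x_j = R ω^j`. -/
def collocationPoint (R : ℝ) (N j : ℕ) : ℂ := (R : ℂ) * omega N ^ j

/-- The charge points `y_k = ρ ω^k`. -/
def chargePoint (ρ : ℝ) (N k : ℕ) : ℂ := (ρ : ℂ) * omega N ^ k

/-- The outward normal derivative of `x ↦ K₀(α |x - y|)` at the point `x` of the circle of
radius `|x|` around the origin, computed with `K₀' = -K₁`. -/
def normalDerivK (α : ℝ) (x y : ℂ) : ℝ :=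
  -α * besselK 1 (α * ‖x - y‖)
    * ((‖x‖ - (x / (‖x‖ : ℂ) * (starRingEnd ℂ) y).re) / ‖x - y‖)

/-- The collocation matrix `G = (c_{k,j})`, `1 ≤ k, j ≤ N`; the index `k : Fin N` stands
for `k + 1`. -/
def matrixG (α R ρ : ℝ) (N : ℕ) : Matrix (Fin N) (Fin N) ℂ :=
  Matrix.of fun k j : Fin N =>
    ((normalDerivK α (collocationPoint R N ((j : ℕ) + 1))
      (chargePoint ρ N ((k : ℕ) + 1)) : ℝ) : ℂ)

/-- `f(x) = ∑_{l < N} c_l x^l`, where `c_l = c(2πl/N)`. -/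
def eigenPoly (α R ρ : ℝ) (N : ℕ) (x : ℂ) : ℂ :=
  ∑ l ∈ Finset.range N,
    ((kernel α R ρ (2 * Real.pi * (l : ℝ) / (N : ℝ)) : ℝ) : ℂ) * x ^ l

end

end MFS

namespace MFS

open MeasureTheory Filter Topology

/-! Everything rests on the closed form `Ã_n = αR K_n(αρ) I_n'(αR)` (`tildeA_eq`). The recurrences
of `K` and `I` make `A_n` a constant times `W_n - W_{n+2}`, with `W_n` the `crossProduct` at `x =
αρ`, `y = αR`. Since `W_n → 0`, each sum of `A_{n+2r}` is a multiple of `W_n`, and the combination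
defining `Ã_n` collapses.

The expansion of `c` is then the normal derivative of Graf's addition theorem (`hasSum_addition`).
Inserting `2 K_n(x) = ∫ exp(nt - x cosh t) dt` and summing by the generating function of `I_n'` at
`t + iθ` leaves one integral with exponent `y cosh(t + iθ) - x cosh t = -D cosh(t - iφ)`, where `D
e^{iφ} = x - y e^{-iθ}`. Moving the contour by `iφ` turns it into `K_1(D)`.

`G` depends only on `j - k` modulo `N`, so a Vandermonde matrix of roots of unity diagonalizes it,
and orthogonality of these roots turns `f(ω^m)` into an aliased sum of the `Ã_n`. -/

/-! ### Gaussian majorants on the real line -/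

theorem one_add_sq_div_two_le_cosh (t : ℝ) : 1 + t ^ 2 / 2 ≤ Real.cosh t := by
  have h1 : Real.cosh t = 1 + 2 * Real.sinh (t / 2) ^ 2 := by
    have := Real.cosh_two_mul (t / 2)
    rw [mul_div_cancel₀ t two_ne_zero, Real.cosh_sq] at this
    linarith
  have h2 : (t / 2) ^ 2 ≤ Real.sinh (t / 2) ^ 2 := by
    rw [sq_le_sq, Real.abs_sinh]
    exact Real.self_le_sinh_iff.2 (abs_nonneg _)
  nlinarith

theorem integrable_exp_sub_cosh {a : ℝ} (ha : 0 < a) (b : ℝ) :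
    Integrable fun t : ℝ => Real.exp (b * t - a * Real.cosh t) := by
  have h := (integrable_cexp_quadratic (b := ((a / 2 : ℝ) : ℂ)) (by simpa using ha) (b : ℂ) 0).norm
  refine h.mono' (by fun_prop) (Eventually.of_forall fun t => ?_)
  rw [Real.norm_of_nonneg (Real.exp_pos _).le, Complex.norm_exp]
  refine Real.exp_le_exp.2 ?_
  have : (-((a / 2 : ℝ) : ℂ) * (t : ℂ) ^ 2 + (b : ℂ) * (t : ℂ) + 0).re = -(a / 2) * t ^ 2 + b * t := by
    norm_cast
    simp
  rw [this]
  nlinarith [one_add_sq_div_two_le_cosh t]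

theorem integrable_cosh_mul_exp_sub_cosh {a : ℝ} (ha : 0 < a) (b : ℝ) :
    Integrable fun t : ℝ => Real.cosh t * Real.exp (b * t - a * Real.cosh t) := by
  have h := ((integrable_exp_sub_cosh ha (b + 1)).add (integrable_exp_sub_cosh ha (b - 1))).div_const 2
  refine h.congr (Eventually.of_forall fun t => ?_)
  have h1 : (b + 1) * t - a * Real.cosh t = t + (b * t - a * Real.cosh t) := by ring
  have h2 : (b - 1) * t - a * Real.cosh t = -t + (b * t - a * Real.cosh t) := by ring
  simp only [Pi.add_apply, h1, h2]
  rw [Real.exp_add, Real.exp_add, ← add_mul, mul_div_right_comm, ← Real.cosh_eq]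

/-! ### Contour shift for the Bessel integral -/

/-- The entire function `s ↦ exp (b s - D cosh s)`, whose integral along the real line is a
modified Bessel function of the second kind. -/
noncomputable def besselPhase (D b : ℝ) (s : ℂ) : ℂ := Complex.exp (b * s - D * Complex.cosh s)

theorem hasDerivAt_besselPhase (D b : ℝ) (s : ℂ) :
    HasDerivAt (besselPhase D b) ((b - D * Complex.sinh s) * besselPhase D b s) s := by
  have h := ((hasDerivAt_id s).const_mul (b : ℂ)).sub ((Complex.hasDerivAt_cosh s).const_mul (D : ℂ))
  have h2 := h.cexp
  rw [mul_comm]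
  simp only [mul_one] at h2
  exact h2

theorem continuous_besselPhase (D b : ℝ) : Continuous (besselPhase D b) := by
  unfold besselPhase
  fun_prop

/-- The real part of `cosh (t - iφ)` is `cos φ cosh t`, so decay persists on horizontal lines with
`cos φ > 0`. -/
theorem norm_besselPhase (D b t φ : ℝ) :
    ‖besselPhase D b (t - φ * Complex.I)‖ = Real.exp (b * t - D * Real.cos φ * Real.cosh t) := by
  rw [besselPhase, Complex.norm_exp, Complex.cosh_sub, Complex.cosh_mul_I, Complex.sinh_mul_I,
    ← Complex.ofReal_cosh, ← Complex.ofReal_sinh, ← Complex.ofReal_cos, ← Complex.ofReal_sin]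
  congr 1
  simp [-Complex.ofReal_cos]
  ring

theorem norm_sinh_le_cosh_re (s : ℂ) : ‖Complex.sinh s‖ ≤ Real.cosh s.re := by
  rw [Complex.sinh, norm_div, Real.cosh_eq]
  have := norm_sub_le (Complex.exp s) (Complex.exp (-s))
  rw [Complex.norm_exp, Complex.norm_exp] at this
  simpa using div_le_div_of_nonneg_right this (by norm_num : (0:ℝ) ≤ 2)

theorem integrable_besselPhase {D φ : ℝ} (hD : 0 < D) (hφ : 0 < Real.cos φ) (b : ℝ) :
    Integrable fun t : ℝ => besselPhase D b (t - φ * Complex.I) := by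
  refine (integrable_exp_sub_cosh (mul_pos hD hφ) b).mono' ?_
    (Eventually.of_forall fun t => (norm_besselPhase D b t φ).le)
  exact ((continuous_besselPhase D b).comp (by fun_prop)).aestronglyMeasurable

theorem norm_deriv_besselPhase_le {D c : ℝ} (hD : 0 < D) (b t φ : ℝ) (hc : c ≤ Real.cos φ) :
    ‖(b - D * Complex.sinh (t - φ * Complex.I)) * besselPhase D b (t - φ * Complex.I)‖ ≤
      |b| * Real.exp (b * t - D * c * Real.cosh t) +
        D * (Real.cosh t * Real.exp (b * t - D * c * Real.cosh t)) := by
  rw [norm_mul, norm_besselPhase]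
  have h1 : ‖(b : ℂ) - D * Complex.sinh (t - φ * Complex.I)‖ ≤ |b| + D * Real.cosh t := by
    refine (norm_sub_le _ _).trans ?_
    have := norm_sinh_le_cosh_re (t - φ * Complex.I)
    simp only [Complex.sub_re, Complex.ofReal_re, Complex.re_ofReal_mul, Complex.I_re, mul_zero,
      sub_zero] at this
    rw [norm_mul, Complex.norm_real, Complex.norm_real, Real.norm_eq_abs, Real.norm_of_nonneg hD.le]
    gcongr
  have h2 : Real.exp (b * t - D * Real.cos φ * Real.cosh t) ≤
      Real.exp (b * t - D * c * Real.cosh t) := by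
    have := Real.cosh_pos t
    gcongr
  calc _ ≤ (|b| + D * Real.cosh t) * Real.exp (b * t - D * c * Real.cosh t) := by
        have := Real.cosh_pos t
        gcongr
    _ = _ := by ring

theorem integrable_deriv_besselPhase_bound {a : ℝ} (ha : 0 < a) (D b : ℝ) :
    Integrable fun t : ℝ => |b| * Real.exp (b * t - a * Real.cosh t) +
        D * (Real.cosh t * Real.exp (b * t - a * Real.cosh t)) :=
  ((integrable_exp_sub_cosh ha b).const_mul _).add
    ((integrable_cosh_mul_exp_sub_cosh ha b).const_mul _)

theorem continuous_deriv_besselPhase (D b : ℝ) :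
    Continuous fun s : ℂ => ((b : ℂ) - D * Complex.sinh s) * besselPhase D b s := by
  have := continuous_besselPhase D b
  fun_prop

/-- The integrand is a total derivative along the horizontal line. This yields both the contour
shift and the recurrence of `K`. -/
theorem integral_deriv_besselPhase_eq_zero {D φ : ℝ} (hD : 0 < D) (hφ : 0 < Real.cos φ) (b : ℝ) :
    ∫ t : ℝ, ((b : ℂ) - D * Complex.sinh (t - φ * Complex.I)) *
      besselPhase D b (t - φ * Complex.I) = 0 := by
  refine integral_eq_zero_of_hasDerivAt_of_integrable (fun t => ?_) ?_
    (integrable_besselPhase hD hφ b)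
  · have h1 : HasDerivAt (fun t : ℝ => (t : ℂ) - φ * Complex.I) 1 t :=
      (Complex.ofRealCLM.hasDerivAt (x := t)).sub_const _
    have := (hasDerivAt_besselPhase D b _).comp t h1
    rwa [mul_one] at this
  · refine (integrable_deriv_besselPhase_bound (mul_pos hD hφ) D b).mono' ?_
      (Eventually.of_forall fun t => norm_deriv_besselPhase_le hD b t φ le_rfl)
    exact ((continuous_deriv_besselPhase D b).comp (by fun_prop)).aestronglyMeasurable

/-- Differentiating in the height of the line gives `-i` times the derivative along it, which
integrates to zero. This replaces Cauchy's theorem on rectangles. -/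
theorem hasDerivAt_integral_besselPhase {D φ : ℝ} (hD : 0 < D)
    (hφ : φ ∈ Set.Ioo (-(Real.pi / 2)) (Real.pi / 2)) (b : ℝ) :
    HasDerivAt (fun ψ : ℝ => ∫ t : ℝ, besselPhase D b (t - ψ * Complex.I)) 0 φ := by
  -- On `(-δ, δ)` the bound `cos ψ ≥ cos δ > 0` provides one integrable majorant near `φ`.
  obtain ⟨δ, hδ, hδ'⟩ := exists_between (abs_lt.2 ⟨hφ.1, hφ.2⟩)
  have hδ0 : 0 ≤ δ := (abs_nonneg _).trans hδ.le
  have hc : 0 < Real.cos δ := Real.cos_pos_of_mem_Ioo ⟨by linarith, hδ'⟩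
  have hcos : ∀ ψ ∈ Set.Ioo (-δ) δ, Real.cos δ ≤ Real.cos ψ := fun ψ hψ => by
    rw [← Real.cos_abs ψ]
    exact Real.cos_le_cos_of_nonneg_of_le_pi (abs_nonneg _) (by linarith [Real.pi_pos])
      (abs_lt.2 hψ).le
  have hmem : φ ∈ Set.Ioo (-δ) δ := abs_lt.1 hδ
  have hφc : 0 < Real.cos φ := hc.trans_le (hcos φ hmem)
  have key := (hasDerivAt_integral_of_dominated_loc_of_deriv_le (μ := volume)
    (F := fun (ψ : ℝ) (t : ℝ) => besselPhase D b (t - ψ * Complex.I))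
    (F' := fun (ψ : ℝ) (t : ℝ) => -Complex.I * (((b : ℂ) - D * Complex.sinh (t - ψ * Complex.I)) *
      besselPhase D b (t - ψ * Complex.I)))
    (bound := fun t : ℝ => |b| * Real.exp (b * t - D * Real.cos δ * Real.cosh t) +
        D * (Real.cosh t * Real.exp (b * t - D * Real.cos δ * Real.cosh t)))
    (Ioo_mem_nhds hmem.1 hmem.2)
    (Eventually.of_forall fun ψ =>
      ((continuous_besselPhase D b).comp (by fun_prop)).aestronglyMeasurable)
    (integrable_besselPhase hD hφc b)
    (continuous_const.mul
      ((continuous_deriv_besselPhase D b).comp (by fun_prop))).aestronglyMeasurable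
    (Eventually.of_forall fun t ψ hψ => ?_)
    (integrable_deriv_besselPhase_bound (mul_pos hD hc) D b)
    (Eventually.of_forall fun t ψ _ => ?_)).2
  · rwa [integral_const_mul, integral_deriv_besselPhase_eq_zero hD hφc, mul_zero] at key
  · rw [norm_mul, norm_neg, Complex.norm_I, one_mul]
    exact norm_deriv_besselPhase_le hD b t ψ (hcos ψ hψ)
  · have h1 : HasDerivAt (fun ψ : ℝ => (t : ℂ) - ψ * Complex.I) (-Complex.I) ψ := by
      simpa using ((Complex.ofRealCLM.hasDerivAt (x := ψ)).mul_const Complex.I).const_sub (t : ℂ)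
    have := (hasDerivAt_besselPhase D b _).comp ψ h1
    rwa [mul_comm] at this

theorem integral_besselPhase_shift {D φ : ℝ} (hD : 0 < D)
    (hφ : φ ∈ Set.Ioo (-(Real.pi / 2)) (Real.pi / 2)) (b : ℝ) :
    ∫ t : ℝ, besselPhase D b (t - φ * Complex.I) = ∫ t : ℝ, besselPhase D b t := by
  have h0 : (0 : ℝ) ∈ Set.Ioo (-(Real.pi / 2)) (Real.pi / 2) := by
    constructor <;> linarith [Real.pi_pos]
  have := isOpen_Ioo.is_const_of_deriv_eq_zero isPreconnected_Ioo
    (fun ψ hψ => (hasDerivAt_integral_besselPhase hD hψ b).differentiableAt.differentiableWithinAt)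
    (fun ψ hψ => (hasDerivAt_integral_besselPhase hD hψ b).deriv) hφ h0
  simpa using this

/-! ### Modified Bessel functions of the second kind -/

theorem integral_besselPhase_eq_besselK {x : ℝ} (hx : 0 < x) (n : ℤ) :
    ∫ t : ℝ, besselPhase x n t = (2 * besselK n.natAbs x : ℝ) := by
  have hre : ∀ t : ℝ, besselPhase x n t = (Real.exp (n * t - x * Real.cosh t) : ℝ) := fun t => by
    simp [besselPhase]
  have hp := integrable_exp_sub_cosh hx (n : ℝ)
  have hm := integrable_exp_sub_cosh hx (-(n : ℝ))
  have hneg : ∫ t : ℝ, Real.exp (-n * t - x * Real.cosh t) =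
      ∫ t : ℝ, Real.exp (n * t - x * Real.cosh t) := by
    rw [← integral_neg_eq_self]
    simp
  have habs := integral_comp_abs (f := fun t => Real.exp (-x * Real.cosh t) * Real.cosh (n.natAbs * t))
  have hcosh (t : ℝ) : Real.exp (-x * Real.cosh |t|) * Real.cosh (n.natAbs * |t|) =
      (Real.exp (n * t - x * Real.cosh t) + Real.exp (-n * t - x * Real.cosh t)) / 2 := by
    have h1 : Real.cosh ((n.natAbs : ℝ) * |t|) = Real.cosh (n * t) := by
      rw [← Real.cosh_abs (n * t), abs_mul, Nat.cast_natAbs, Int.cast_abs]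
    rw [Real.cosh_abs, h1, Real.cosh_eq (n * t), mul_div_assoc', mul_add, ← Real.exp_add,
      ← Real.exp_add]
    ring_nf
  simp only [hcosh] at habs
  rw [integral_div, integral_add hp hm, hneg] at habs
  simp only [hre]
  rw [integral_complex_ofReal]
  norm_cast
  rw [besselK, ← habs]
  ring

theorem besselK_nonneg (n : ℕ) (x : ℝ) : 0 ≤ besselK n x :=
  integral_nonneg fun _ => mul_nonneg (Real.exp_pos _).le (Real.cosh_pos _).le

/-- Integrate the derivative of `besselPhase x (n + 1)`: the factor `sinh` raises and lowers the
index by one. -/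
theorem besselK_recurrence {x : ℝ} (hx : 0 < x) (n : ℕ) :
    x * (besselK (n + 2) x - besselK n x) = 2 * (n + 1) * besselK (n + 1) x := by
  have h := integral_deriv_besselPhase_eq_zero (φ := 0) hx (by simp) ((n + 1 : ℕ) : ℝ)
  have hint : ∀ m : ℕ, Integrable fun t : ℝ => besselPhase x m t := fun m => by
    simpa using integrable_besselPhase (φ := 0) hx (by simp) (m : ℝ)
  have hval : ∀ m : ℕ, ∫ t : ℝ, besselPhase x m t = (2 * besselK m x : ℝ) := fun m => by
    simpa using integral_besselPhase_eq_besselK hx (m : ℤ)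
  have hsplit : ∀ t : ℝ, ((((n + 1 : ℕ) : ℝ) : ℂ) - x * Complex.sinh (t - (0 : ℝ) * Complex.I)) *
      besselPhase x (n + 1 : ℕ) (t - (0 : ℝ) * Complex.I) =
      (n + 1) * besselPhase x (n + 1 : ℕ) t -
        (x / 2 * besselPhase x (n + 2 : ℕ) t - x / 2 * besselPhase x n t) := fun t => by
    have e1 : besselPhase x (n + 2 : ℕ) t = Complex.exp t * besselPhase x (n + 1 : ℕ) t := by
      rw [besselPhase, besselPhase, ← Complex.exp_add]
      push_cast
      ring_nf
    have e2 : besselPhase x n t = Complex.exp (-t) * besselPhase x (n + 1 : ℕ) t := by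
      rw [besselPhase, besselPhase, ← Complex.exp_add]
      push_cast
      ring_nf
    rw [e1, e2, Complex.sinh]
    push_cast
    simp only [zero_mul, sub_zero]
    ring
  simp only [hsplit] at h
  rw [integral_sub ((hint (n + 1)).const_mul _)
    (((hint (n + 2)).const_mul _).sub ((hint n).const_mul _) :
      Integrable fun t : ℝ => (x / 2 : ℂ) * besselPhase x (n + 2 : ℕ) t -
        x / 2 * besselPhase x n t),
    integral_sub ((hint _).const_mul _) ((hint _).const_mul _), integral_const_mul,
    integral_const_mul, integral_const_mul, hval, hval, hval] at h
  norm_cast at h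
  push_cast at h
  have h' : ((n : ℝ) + 1) * (2 * besselK (n + 1) x) -
      (x / 2 * (2 * besselK (n + 2) x) - x / 2 * (2 * besselK n x)) = 0 := by exact_mod_cast h
  linarith

/-! ### Modified Bessel functions of the first kind -/

theorem summable_besselI (n : ℕ) (x : ℝ) : Summable fun k : ℕ =>
    (x / 2) ^ (2 * k + n) / ((Nat.factorial k : ℝ) * (Nat.factorial (n + k) : ℝ)) := by
  have h := (Real.summable_pow_div_factorial ((x / 2) ^ 2)).norm.mul_left (|x / 2| ^ n)
  refine h.of_norm_bounded fun k => ?_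
  have h1 : (1 : ℝ) ≤ Nat.factorial (n + k) := by exact_mod_cast Nat.one_le_iff_ne_zero.2 (Nat.factorial_ne_zero _)
  have h0 : (0 : ℝ) < Nat.factorial k := by exact_mod_cast Nat.factorial_pos k
  rw [norm_div, norm_div, norm_pow, norm_pow, norm_pow, norm_mul, Real.norm_natCast, Real.norm_natCast, Real.norm_eq_abs,
    mul_div_assoc', ← pow_mul, ← pow_add, add_comm _ n]
  exact div_le_div_of_nonneg_left (by positivity) h0 (by nlinarith)

theorem besselI_nonneg (n : ℕ) {x : ℝ} (hx : 0 ≤ x) : 0 ≤ besselI n x :=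
  tsum_nonneg fun k => by positivity

theorem besselI_recurrence (n : ℕ) (x : ℝ) :
    x * (besselI n x - besselI (n + 2) x) = 2 * (n + 1) * besselI (n + 1) x := by
  have h0 := (summable_besselI n x).hasSum
  have h1 := ((summable_besselI (n + 1) x).hasSum.mul_left (2 * ((n : ℝ) + 1)))
  have h2 := (summable_besselI (n + 2) x).hasSum.mul_left x
  -- The series of `I_{n+2}` is reindexed by one to match the powers in that of `I_n`; the factor
  -- `k` makes the added zeroth term vanish.
  have h2' : HasSum (fun k : ℕ => x * ((k : ℝ) * ((x / 2) ^ (2 * k + n) /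
      ((Nat.factorial k : ℝ) * (Nat.factorial (n + k + 1) : ℝ))))) (x * besselI (n + 2) x) := by
    rw [← hasSum_nat_add_iff' 1]
    simp only [Finset.range_one, Finset.sum_singleton, Nat.cast_zero, zero_mul, mul_zero, sub_zero]
    refine h2.congr_fun fun k => ?_
    rw [Nat.factorial_succ k, show n + (k + 1) + 1 = n + 2 + k by ring,
      show 2 * (k + 1) + n = 2 * k + (n + 2) by ring]
    push_cast
    have : ((k : ℝ) + 1) ≠ 0 := by positivity
    field_simp
  have hd := (h0.mul_left x).sub h2'
  rw [mul_sub]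
  refine hd.unique (h1.congr_fun fun k => ?_)
  rw [show n + 1 + k = n + k + 1 by ring, Nat.factorial_succ (n + k),
    show 2 * k + (n + 1) = (2 * k + n) + 1 by ring, pow_succ]
  push_cast
  have : ((n : ℝ) + k + 1) ≠ 0 := by positivity
  field_simp
  ring

/-- Pairs of natural numbers, parametrized by their difference and their minimum. -/
def subMinEquiv : ℤ × ℕ ≃ ℕ × ℕ where
  toFun p := (p.2 + p.1.toNat, p.2 + (-p.1).toNat)
  invFun q := ((q.1 : ℤ) - q.2, min q.1 q.2)
  left_inv := by
    rintro ⟨n, k⟩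
    simp only [Prod.mk.injEq]
    omega
  right_inv := by
    rintro ⟨i, j⟩
    simp only [Prod.mk.injEq]
    omega

theorem hasSum_pow_div_factorial (z : ℂ) :
    HasSum (fun k : ℕ => z ^ k / (Nat.factorial k : ℂ)) (Complex.exp z) := by
  rw [Complex.exp_eq_exp_ℂ]
  exact NormedSpace.expSeries_div_hasSum_exp z

theorem hasSum_mul_prod {f g : ℕ → ℂ} {a b : ℂ} (hf : HasSum f a) (hg : HasSum g b) :
    HasSum (fun q : ℕ × ℕ => f q.1 * g q.2) (a * b) :=
  hf.mul hg (summable_mul_of_summable_norm hf.summable.norm hg.summable.norm)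

/-- The generating function of the modified Bessel functions of the first kind. -/
theorem hasSum_besselI_mul_zpow (x : ℝ) {w : ℂ} (hw : w ≠ 0) :
    HasSum (fun n : ℤ => (besselI n.natAbs x : ℂ) * w ^ n)
      (Complex.exp (x / 2 * (w + w⁻¹))) := by
  have hprod := hasSum_mul_prod (hasSum_pow_div_factorial (x / 2 * w))
    (hasSum_pow_div_factorial (x / 2 * w⁻¹))
  rw [← Complex.exp_add, ← mul_add] at hprod
  -- In the product of the exponential series in `w` and `w⁻¹`, the pairs of exponents with
  -- difference `n` contribute the series of `I_{|n|}`.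
  rw [← subMinEquiv.hasSum_iff] at hprod
  refine hprod.prod_fiberwise fun n => ?_
  have hI := (summable_besselI n.natAbs x).hasSum
  rw [← Complex.hasSum_ofReal] at hI
  refine (hI.mul_right (w ^ n)).congr_fun fun k => ?_
  rcases Int.eq_nat_or_neg n with ⟨m, rfl | rfl⟩
  · simp only [subMinEquiv, Function.comp, Equiv.coe_fn_mk, Int.toNat_natCast, Int.toNat_neg_natCast, add_zero,
      Int.natAbs_natCast, zpow_natCast]
    push_cast
    rw [mul_pow, mul_pow, inv_pow w, pow_add w, add_comm m k, show 2 * k + m = (k + m) + k by ring, pow_add _ (k + m) k]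
    field_simp
  · simp only [subMinEquiv, Function.comp, Equiv.coe_fn_mk, neg_neg, Int.toNat_natCast, Int.toNat_neg_natCast, add_zero,
      Int.natAbs_natCast, Int.natAbs_neg, zpow_neg, zpow_natCast]
    push_cast
    rw [mul_pow, mul_pow, inv_pow w, pow_add w, add_comm m k, show 2 * k + m = k + (k + m) by ring, pow_add _ k (k + m)]
    field_simp

theorem hasSum_besselI_add_mul_zpow (x : ℝ) {w : ℂ} (hw : w ≠ 0) :
    HasSum (fun n : ℤ => ((besselI (n - 1).natAbs x + besselI (n + 1).natAbs x : ℝ) : ℂ) * w ^ n)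
      ((w + w⁻¹) * Complex.exp (x / 2 * (w + w⁻¹))) := by
  have h := hasSum_besselI_mul_zpow x hw
  have h1 := ((Equiv.subRight (1 : ℤ)).hasSum_iff.2 h).mul_left w
  have h2 := ((Equiv.addRight (1 : ℤ)).hasSum_iff.2 h).mul_left w⁻¹
  rw [add_mul]
  refine (h1.add h2).congr_fun fun n => ?_
  simp only [Function.comp, Equiv.subRight_apply, Equiv.coe_addRight, zpow_sub₀ hw,
    zpow_add₀ hw, zpow_one]
  push_cast
  field_simp

/-! ### The addition theorem -/

/-- The coefficient `(I_{n-1}(y) + I_{n+1}(y)) / 2 = I_n'(y)`. -/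
noncomputable def besselIDeriv (n : ℤ) (y : ℝ) : ℝ :=
  (besselI (n - 1).natAbs y + besselI (n + 1).natAbs y) / 2

theorem besselIDeriv_nonneg (n : ℤ) {y : ℝ} (hy : 0 ≤ y) : 0 ≤ besselIDeriv n y :=
  div_nonneg (add_nonneg (besselI_nonneg _ hy) (besselI_nonneg _ hy)) two_pos.le

theorem hasSum_besselIDeriv_mul_exp (y : ℝ) (s : ℂ) :
    HasSum (fun n : ℤ => (besselIDeriv n y : ℂ) * Complex.exp (n * s))
      (Complex.cosh s * Complex.exp (y * Complex.cosh s)) := by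
  have h := (hasSum_besselI_add_mul_zpow y (Complex.exp_ne_zero s)).div_const 2
  rw [← Complex.exp_neg] at h
  have e1 : Complex.exp s + Complex.exp (-s) = 2 * Complex.cosh s := by
    rw [Complex.cosh]
    ring
  have e2 : (y : ℂ) / 2 * (2 * Complex.cosh s) = y * Complex.cosh s := by ring
  rw [e1, e2] at h
  convert! h using 1
  · ext n
    rw [← Complex.exp_int_mul, besselIDeriv]
    push_cast
    ring
  · ring

theorem hasSum_besselIDeriv_mul_exp_real (y t : ℝ) :
    HasSum (fun n : ℤ => besselIDeriv n y * Real.exp (n * t))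
      (Real.cosh t * Real.exp (y * Real.cosh t)) := by
  have h := hasSum_besselIDeriv_mul_exp y t
  rw [← Complex.hasSum_ofReal]
  simpa using h

/-- Sum and integral are interchanged. The norms of the terms sum to the generating function at `θ =
0`, giving the majorant `cosh t exp(-(x - y) cosh t)`, integrable because `y < x`. -/
theorem hasSum_besselK_mul_besselIDeriv_mul_exp {x y : ℝ} (hy : 0 ≤ y) (hxy : y < x) (θ : ℝ) :
    HasSum (fun n : ℤ => ((besselK n.natAbs x * besselIDeriv n y : ℝ) : ℂ) *
        Complex.exp (Complex.I * n * θ))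
      (1 / 2 * ∫ t : ℝ, Complex.cosh (t + θ * Complex.I) *
        Complex.exp (y * Complex.cosh (t + θ * Complex.I) - x * Complex.cosh t)) := by
  have hx : 0 < x := hy.trans_lt hxy
  have hsumm : ∀ t : ℝ, HasSum
      (fun n : ℤ => besselIDeriv n y * Real.exp (n * t) * Real.exp (-(x * Real.cosh t)))
      (Real.cosh t * Real.exp (0 * t - (x - y) * Real.cosh t)) := fun t => by
    convert! (hasSum_besselIDeriv_mul_exp_real y t).mul_right (Real.exp (-(x * Real.cosh t))) using 1
    rw [mul_assoc, ← Real.exp_add]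
    ring_nf
  have key := hasSum_integral_of_dominated_convergence (μ := (volume : Measure ℝ))
    (F := fun (n : ℤ) (t : ℝ) => (besselIDeriv n y : ℂ) * Complex.exp (Complex.I * n * θ) *
      besselPhase x n t)
    (f := fun t : ℝ => Complex.cosh (t + θ * Complex.I) *
        Complex.exp (y * Complex.cosh (t + θ * Complex.I) - x * Complex.cosh t))
    (fun (n : ℤ) (t : ℝ) =>
      besselIDeriv n y * Real.exp (n * t) * Real.exp (-(x * Real.cosh t)))
    (fun n => (((continuous_besselPhase x n).comp (by fun_prop)).const_mul _ :
      Continuous fun t : ℝ => _ * besselPhase x n t).aestronglyMeasurable)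
    (fun n => Eventually.of_forall fun t => le_of_eq ?_)
    (Eventually.of_forall fun t => (hsumm t).summable) ?_
    (Eventually.of_forall fun t => ?_)
  · refine (key.mul_left (1 / 2)).congr_fun fun n => ?_
    rw [integral_const_mul, integral_besselPhase_eq_besselK hx]
    push_cast
    ring
  · have h := norm_besselPhase x n t 0
    simp only [Complex.ofReal_zero, zero_mul, sub_zero, Real.cos_zero, mul_one] at h
    have h2 : ‖Complex.exp (Complex.I * n * θ)‖ = 1 := by
      rw [Complex.norm_exp]
      simp
    rw [norm_mul, norm_mul, h, h2, Complex.norm_real, Real.norm_of_nonneg (besselIDeriv_nonneg n hy),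
      mul_one, mul_assoc, ← Real.exp_add, sub_eq_add_neg]
  · simp only [fun t => (hsumm t).tsum_eq]
    exact integrable_cosh_mul_exp_sub_cosh (sub_pos.2 hxy) 0
  · have h := (hasSum_besselIDeriv_mul_exp y (t + θ * Complex.I)).mul_right
      (Complex.exp (-(x * Complex.cosh t)))
    convert! h using 1
    · ext n
      rw [besselPhase, mul_assoc, ← Complex.exp_add, mul_assoc (besselIDeriv n y : ℂ),
        ← Complex.exp_add]
      congr 2
      push_cast
      ring
    · rw [mul_assoc, ← Complex.exp_add, sub_eq_add_neg]

/-- With `s = t - iφ` one has `t + iθ = s + i(φ + θ)`, so `cosh` splits into the phases with `b =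
±1`, and each integral shifts back to the real line. -/
theorem integral_cosh_mul_exp {D φ : ℝ} (hD : 0 < D)
    (hφ : φ ∈ Set.Ioo (-(Real.pi / 2)) (Real.pi / 2)) (θ : ℝ) :
    ∫ t : ℝ, Complex.cosh (t + θ * Complex.I) * Complex.exp (-(D * Complex.cosh (t - φ * Complex.I)))
      = (2 * Real.cos (φ + θ) * besselK 1 D : ℝ) := by
  have hc := Real.cos_pos_of_mem_Ioo hφ
  have hK1 : ∫ t : ℝ, besselPhase D 1 (t - φ * Complex.I) = (2 * besselK 1 D : ℝ) := by
    rw [integral_besselPhase_shift hD hφ]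
    simpa using integral_besselPhase_eq_besselK hD 1
  have hK2 : ∫ t : ℝ, besselPhase D (-1) (t - φ * Complex.I) = (2 * besselK 1 D : ℝ) := by
    rw [integral_besselPhase_shift hD hφ]
    simpa using integral_besselPhase_eq_besselK hD (-1)
  have hsplit : ∀ t : ℝ, Complex.cosh (t + θ * Complex.I) *
      Complex.exp (-(D * Complex.cosh (t - φ * Complex.I))) =
      Complex.exp ((φ + θ) * Complex.I) / 2 * besselPhase D 1 (t - φ * Complex.I) +
      Complex.exp (-((φ + θ) * Complex.I)) / 2 * besselPhase D (-1) (t - φ * Complex.I) := fun t => by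
    rw [besselPhase, besselPhase, Complex.cosh, div_mul_eq_mul_div, div_mul_eq_mul_div,
      div_mul_eq_mul_div, ← Complex.exp_add, ← Complex.exp_add, add_mul, ← Complex.exp_add,
      ← Complex.exp_add, add_div]
    push_cast
    ring_nf
  simp only [hsplit]
  rw [integral_add ((integrable_besselPhase hD hc _).const_mul _)
    ((integrable_besselPhase hD hc _).const_mul _), integral_const_mul, integral_const_mul,
    hK1, hK2]
  push_cast
  rw [Complex.cos]
  ring_nf

/-- The normal derivative of Graf's addition theorem. -/
theorem hasSum_addition {x y : ℝ} (hy : 0 < y) (hxy : y < x) (θ : ℝ) {D : ℝ} (hD : 0 < D)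
    (hD2 : D ^ 2 = x ^ 2 + y ^ 2 - 2 * x * y * Real.cos θ) :
    HasSum (fun n : ℤ => ((besselK n.natAbs x * besselIDeriv n y : ℝ) : ℂ) *
        Complex.exp (Complex.I * n * θ))
      (besselK 1 D * ((x * Real.cos θ - y) / D) : ℝ) := by
  -- `z = x - y e^{-iθ}` has modulus `D`, and `y < x` puts its argument in the strip where the
  -- contour may be shifted.
  set z : ℂ := ⟨x - y * Real.cos θ, y * Real.sin θ⟩ with hz
  have hre : 0 < z.re := by
    show 0 < x - y * Real.cos θ
    nlinarith [Real.cos_le_one θ]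
  have hnorm : ‖z‖ = D := by
    rw [← abs_of_pos hD, ← abs_norm, ← sq_eq_sq_iff_abs_eq_abs, ← Complex.normSq_eq_norm_sq, hD2,
      Complex.normSq_apply]
    simp only [hz]
    nlinarith [Real.sin_sq_add_cos_sq θ]
  have hφ : z.arg ∈ Set.Ioo (-(Real.pi / 2)) (Real.pi / 2) :=
    abs_lt.1 (Complex.abs_arg_lt_pi_div_two_iff.2 (Or.inl hre))
  have hcos : D * Real.cos z.arg = x - y * Real.cos θ := by
    rw [← hnorm, Complex.norm_mul_cos_arg]
  have hsin : D * Real.sin z.arg = y * Real.sin θ := by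
    rw [← hnorm, Complex.norm_mul_sin_arg]
  have h := hasSum_besselK_mul_besselIDeriv_mul_exp hy.le hxy θ
  have hcosC : (D : ℂ) * Complex.cos z.arg = x - y * Complex.cos θ := by exact_mod_cast hcos
  have hsinC : (D : ℂ) * Complex.sin z.arg = y * Complex.sin θ := by exact_mod_cast hsin
  have hexp : ∀ t : ℝ, (y : ℂ) * Complex.cosh (t + θ * Complex.I) - x * Complex.cosh t =
      -(D * Complex.cosh (t - z.arg * Complex.I)) := fun t => by
    rw [Complex.cosh_sub, Complex.cosh_add, Complex.cosh_mul_I, Complex.cosh_mul_I,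
      Complex.sinh_mul_I, Complex.sinh_mul_I]
    linear_combination Complex.cosh t * hcosC - Complex.I * Complex.sinh t * hsinC
  simp only [hexp] at h
  rw [integral_cosh_mul_exp hD hφ] at h
  convert! h using 1
  -- This is the real part of `z e^{iθ} = x e^{iθ} - y`, divided by `D`.
  have : Real.cos (z.arg + θ) = (x * Real.cos θ - y) / D := by
    rw [eq_div_iff hD.ne', Real.cos_add]
    linear_combination Real.cos θ * hcos - Real.sin θ * hsin - y * Real.sin_sq_add_cos_sq θ
  rw [this]
  push_cast
  ring

theorem summable_besselK_mul_besselIDeriv {x y : ℝ} (hy : 0 < y) (hxy : y < x) :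
    Summable fun n : ℤ => besselK n.natAbs x * besselIDeriv n y := by
  have h := (hasSum_addition hy hxy 0 (sub_pos.2 hxy) (by rw [Real.cos_zero]; ring)).summable
  rw [← Complex.summable_ofReal]
  simpa using h

theorem besselIDeriv_neg (n : ℤ) (y : ℝ) : besselIDeriv (-n) y = besselIDeriv n y := by
  rw [besselIDeriv, besselIDeriv, show -n - 1 = -(n + 1) by ring, show -n + 1 = -(n - 1) by ring,
    Int.natAbs_neg, Int.natAbs_neg, add_comm]

/-! ### The telescoping series -/

/-- The Wronskian-type expression `x K_{n+1}(x) I_n(y) + y K_n(x) I_{n+1}(y)`. -/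
noncomputable def crossProduct (x y : ℝ) (n : ℕ) : ℝ :=
  x * besselK (n + 1) x * besselI n y + y * besselK n x * besselI (n + 1) y

/-- Eliminating `K_{n+2}` and `I_{n+2}` produces two terms `2(n+1) K_{n+1} I_{n+1}` of opposite
sign. -/
theorem crossProduct_succ {x : ℝ} (hx : 0 < x) (y : ℝ) (n : ℕ) :
    crossProduct x y (n + 1) =
      x * besselK n x * besselI (n + 1) y + y * besselK (n + 1) x * besselI n y := by
  have hK := besselK_recurrence hx n
  have hI := besselI_recurrence n y
  unfold crossProduct
  linear_combination besselI (n + 1) y * hK - besselK (n + 1) x * hI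

theorem crossProduct_sub {x : ℝ} (hx : 0 < x) (y : ℝ) (n : ℕ) :
    x * y * (crossProduct x y n - crossProduct x y (n + 2)) =
      2 * (x ^ 2 - y ^ 2) * ((1 + n) * besselK (n + 1) x * besselI (n + 1) y) := by
  have hK := besselK_recurrence hx n
  have hI := besselI_recurrence n y
  rw [crossProduct_succ hx, crossProduct]
  linear_combination x ^ 2 * besselK (n + 1) x * hI - y ^ 2 * besselI (n + 1) y * hK

/-- The combination in `Ã_n` for `|n| = n + 1`; `crossProduct_one_sub` serves `n = 0`, where both
neighbours have absolute value `1`. -/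
theorem crossProduct_add {x : ℝ} (hx : 0 < x) (y : ℝ) (n : ℕ) :
    x * (crossProduct x y n + crossProduct x y (n + 2)) - 2 * y * crossProduct x y (n + 1) =
      (x ^ 2 - y ^ 2) * (besselK (n + 1) x * (besselI n y + besselI (n + 2) y)) := by
  have h1 := crossProduct_succ hx y n
  have h2 := crossProduct_succ hx y (n + 1)
  have h3 : crossProduct x y (n + 1) =
    x * besselK (n + 2) x * besselI (n + 1) y + y * besselK (n + 1) x * besselI (n + 2) y := rfl
  have h4 : crossProduct x y n =
    x * besselK (n + 1) x * besselI n y + y * besselK n x * besselI (n + 1) y := rfl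
  linear_combination x * h4 + x * h2 - y * h1 - y * h3

theorem crossProduct_one_sub {x : ℝ} (hx : 0 < x) (y : ℝ) :
    x * crossProduct x y 1 - y * crossProduct x y 0 =
      (x ^ 2 - y ^ 2) * (besselK 0 x * besselI 1 y) := by
  have h1 := crossProduct_succ hx y 0
  rw [zero_add] at h1
  rw [h1, crossProduct]
  ring

/-- By positivity, `W_n` is at most `2x K_{n+1} I_{n+1}' + 2y K_n I_n'`, built from terms of the
summable addition series at `θ = 0`. -/
theorem tendsto_crossProduct {x y : ℝ} (hy : 0 < y) (hxy : y < x) :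
    Tendsto (crossProduct x y) atTop (𝓝 0) := by
  have hx := hy.trans hxy
  have h := ((summable_besselK_mul_besselIDeriv hy hxy).comp_injective
    Nat.cast_injective).tendsto_atTop_zero
  have h2 := ((h.comp (tendsto_add_atTop_nat 1)).const_mul (2 * x)).add (h.const_mul (2 * y))
  rw [mul_zero, mul_zero, add_zero] at h2
  refine squeeze_zero (fun n => ?_) (fun n => ?_) h2
  · have := besselK_nonneg n x
    have := besselK_nonneg (n + 1) x
    have := besselI_nonneg n hy.le
    have := besselI_nonneg (n + 1) hy.le
    unfold crossProduct
    positivity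
  · simp only [Function.comp, Int.natAbs_natCast, crossProduct, besselIDeriv]
    have e1 : (((n + 1 : ℕ) : ℤ) - 1).natAbs = n := by omega
    have e2 : ((n : ℤ) + 1).natAbs = n + 1 := by omega
    rw [e1, e2]
    have h1 := mul_nonneg (mul_nonneg hx.le (besselK_nonneg (n + 1) x))
      (besselI_nonneg (((n + 1 : ℕ) : ℤ) + 1).natAbs hy.le)
    have h2 := mul_nonneg (mul_nonneg hy.le (besselK_nonneg n x))
      (besselI_nonneg ((n : ℤ) - 1).natAbs hy.le)
    linarith

theorem hasSum_coeffA {α R ρ : ℝ} (hα : 0 < α) (hR : 0 < R) (hρ : R < ρ) (n : ℕ) :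
    HasSum (fun r : ℕ => coeffA α R ρ (n + 2 * r))
      (R * ρ / (2 * (ρ ^ 2 - R ^ 2)) * crossProduct (α * ρ) (α * R) n) := by
  have hρ0 := hR.trans hρ
  have hpos : 0 < ρ ^ 2 - R ^ 2 := by nlinarith
  have hA : ∀ m, coeffA α R ρ m = R * ρ / (2 * (ρ ^ 2 - R ^ 2)) *
      (crossProduct (α * ρ) (α * R) m - crossProduct (α * ρ) (α * R) (m + 2)) := fun m => by
    have h := crossProduct_sub (mul_pos hα hρ0) (α * R) m
    rw [coeffA, div_mul_eq_mul_div, eq_div_iff (by positivity)]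
    -- `crossProduct_sub` at `αρ`, `αR` carries `α²` on both sides.
    apply mul_left_cancel₀ (pow_ne_zero 2 hα.ne')
    linear_combination -h
  have hnonneg : ∀ m, 0 ≤ coeffA α R ρ m := fun m =>
    mul_nonneg (mul_nonneg (by positivity) (besselK_nonneg _ _))
      (besselI_nonneg _ (mul_pos hα hR).le)
  rw [hasSum_iff_tendsto_nat_of_nonneg (fun r => hnonneg _)]
  have hsum : ∀ k, ∑ r ∈ Finset.range k, coeffA α R ρ (n + 2 * r) =
      R * ρ / (2 * (ρ ^ 2 - R ^ 2)) * (crossProduct (α * ρ) (α * R) n -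
        crossProduct (α * ρ) (α * R) (n + 2 * k)) := fun k => by
    simp only [hA, ← Finset.mul_sum]
    exact congrArg _ (Finset.sum_range_sub' (fun r => crossProduct (α * ρ) (α * R) (n + 2 * r)) k)
  simp only [hsum]
  have hlim : Tendsto (fun k : ℕ => crossProduct (α * ρ) (α * R) (n + 2 * k)) atTop (𝓝 0) :=
    (tendsto_crossProduct (mul_pos hα hR) (mul_lt_mul_of_pos_left hρ hα)).comp
      (tendsto_atTop_mono (fun k => by omega : ∀ k, k ≤ n + 2 * k) tendsto_id)
  simpa using (hlim.const_sub (crossProduct (α * ρ) (α * R) n)).const_mul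
    (R * ρ / (2 * (ρ ^ 2 - R ^ 2)))

theorem hasSum_tildeTerm {α R ρ : ℝ} (hα : 0 < α) (hR : 0 < R) (hρ : R < ρ) (n : ℤ) :
    HasSum (tildeTerm α R ρ n)
      (R * (α * (besselK n.natAbs (α * ρ) * besselIDeriv n (α * R)))) := by
  have hρ0 := hR.trans hρ
  have hpos : 0 < ρ ^ 2 - R ^ 2 := by nlinarith
  have hx := mul_pos hα hρ0
  have h := ((hasSum_coeffA hα hR hρ (n - 1).natAbs).add
    (hasSum_coeffA hα hR hρ (n + 1).natAbs)).sub
      ((hasSum_coeffA hα hR hρ n.natAbs).mul_left (2 * R / ρ))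
  have key : α * ρ * (crossProduct (α * ρ) (α * R) (n - 1).natAbs +
      crossProduct (α * ρ) (α * R) (n + 1).natAbs) -
      2 * (α * R) * crossProduct (α * ρ) (α * R) n.natAbs =
      ((α * ρ) ^ 2 - (α * R) ^ 2) *
        (2 * (besselK n.natAbs (α * ρ) * besselIDeriv n (α * R))) := by
    rcases lt_trichotomy n 0 with hn | rfl | hn
    · obtain ⟨m, rfl⟩ : ∃ m : ℕ, n = -(m + 1 : ℕ) := ⟨(-n - 1).toNat, by omega⟩
      have := crossProduct_add hx (α * R) m
      rw [besselIDeriv, show (-((m + 1 : ℕ) : ℤ)).natAbs = m + 1 by omega,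
        show (-((m + 1 : ℕ) : ℤ) - 1).natAbs = m + 2 by omega,
        show (-((m + 1 : ℕ) : ℤ) + 1).natAbs = m by omega]
      linear_combination this
    · have := crossProduct_one_sub hx (α * R)
      simp only [besselIDeriv, zero_sub, zero_add, Int.natAbs_neg, Int.natAbs_one, Int.natAbs_zero]
      linear_combination 2 * this
    · obtain ⟨m, rfl⟩ : ∃ m : ℕ, n = (m + 1 : ℕ) := ⟨(n - 1).toNat, by omega⟩
      have := crossProduct_add hx (α * R) m
      rw [besselIDeriv, show (((m + 1 : ℕ) : ℤ)).natAbs = m + 1 by omega,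
        show (((m + 1 : ℕ) : ℤ) + 1).natAbs = m + 2 by omega,
        show (((m + 1 : ℕ) : ℤ) - 1).natAbs = m by omega]
      linear_combination this
  convert! h using 1
  have hα' := hα.ne'
  have hρ' := hρ0.ne'
  have hp' := hpos.ne'
  generalize crossProduct (α * ρ) (α * R) (n - 1).natAbs = a at key ⊢
  generalize crossProduct (α * ρ) (α * R) (n + 1).natAbs = b at key ⊢
  generalize crossProduct (α * ρ) (α * R) n.natAbs = c at key ⊢
  generalize besselK n.natAbs (α * ρ) * besselIDeriv n (α * R) = e at key ⊢
  field_simp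
  apply mul_left_cancel₀ hα'
  linear_combination -key

theorem tildeA_eq {α R ρ : ℝ} (hα : 0 < α) (hR : 0 < R) (hρ : R < ρ) (n : ℤ) :
    tildeA α R ρ n = R * (α * (besselK n.natAbs (α * ρ) * besselIDeriv n (α * R))) :=
  (hasSum_tildeTerm hα hR hρ n).tsum_eq

theorem tildeA_neg {α R ρ : ℝ} (hα : 0 < α) (hR : 0 < R) (hρ : R < ρ) (n : ℤ) :
    tildeA α R ρ (-n) = tildeA α R ρ n := by
  rw [tildeA_eq hα hR hρ, tildeA_eq hα hR hρ, besselIDeriv_neg, Int.natAbs_neg]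

/-! ### Pointwise expansion of the kernel -/

theorem pointDist_sq (R ρ θ : ℝ) :
    pointDist R ρ θ ^ 2 = ρ ^ 2 + R ^ 2 - 2 * ρ * R * Real.cos θ := by
  rw [pointDist, ← Complex.normSq_eq_norm_sq, Complex.normSq_apply]
  have : -(Complex.I * (θ : ℂ)) = ((-θ : ℝ) : ℂ) * Complex.I := by
    push_cast
    ring
  rw [this, Complex.exp_mul_I, ← Complex.ofReal_cos, ← Complex.ofReal_sin]
  simp only [Real.cos_neg, Real.sin_neg, Complex.sub_re, Complex.sub_im, Complex.ofReal_re,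
    Complex.ofReal_im, Complex.re_ofReal_mul, Complex.im_ofReal_mul, Complex.add_re,
    Complex.add_im, Complex.mul_I_re, Complex.mul_I_im]
  linear_combination ρ ^ 2 * Real.sin_sq_add_cos_sq θ

theorem pointDist_pos {R ρ : ℝ} (hR : 0 < R) (hρ : R < ρ) (θ : ℝ) : 0 < pointDist R ρ θ := by
  refine lt_of_le_of_ne (norm_nonneg _) fun h => ?_
  have := pointDist_sq R ρ θ
  rw [← h] at this
  nlinarith [Real.cos_le_one θ, mul_pos hR (hR.trans hρ)]

/-- The addition theorem with `x = αρ`, `y = αR`, `D = α d(θ)`, multiplied by `α`. -/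
theorem hasSum_kernel {α R ρ : ℝ} (hα : 0 < α) (hR : 0 < R) (hρ : R < ρ) (θ : ℝ) :
    HasSum (fun n : ℤ => (tildeA α R ρ n : ℂ) / R * Complex.exp (Complex.I * n * θ))
      (kernel α R ρ θ : ℂ) := by
  have hd := pointDist_pos hR hρ θ
  have h := (hasSum_addition (mul_pos hα hR) (mul_lt_mul_of_pos_left hρ hα) θ (mul_pos hα hd)
    (by rw [mul_pow, pointDist_sq]; ring)).mul_left (α : ℂ)
  have hR' : (R : ℂ) ≠ 0 := by exact_mod_cast hR.ne'
  convert! h using 1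
  · ext n
    rw [tildeA_eq hα hR hρ]
    push_cast
    rw [mul_div_cancel_left₀ _ hR']
    ring
  · rw [← Complex.ofReal_mul, kernel]
    congr 1
    field_simp
    ring

theorem summable_norm_tildeA_div {α R ρ : ℝ} (hα : 0 < α) (hR : 0 < R) (hρ : R < ρ) :
    Summable fun n : ℤ => ‖(tildeA α R ρ n : ℂ) / R‖ := by
  have h := (hasSum_kernel hα hR hρ 0).summable.norm
  simpa using h

/-! ### Fourier series -/

theorem integral_exp_I_mul_int (k : ℤ) :
    ∫ θ in (0 : ℝ)..(2 * Real.pi), Complex.exp (Complex.I * k * θ) =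
      if k = 0 then 2 * (Real.pi : ℂ) else 0 := by
  split_ifs with hk
  · simp [hk]
  · have hc : Complex.I * (k : ℂ) ≠ 0 := mul_ne_zero Complex.I_ne_zero (Int.cast_ne_zero.2 hk)
    rw [integral_exp_mul_complex hc]
    have : Complex.I * k * ((2 * Real.pi : ℝ) : ℂ) = k * (2 * Real.pi * Complex.I) := by
      push_cast
      ring
    rw [this, Complex.exp_int_mul_two_pi_mul_I]
    simp

theorem integral_fourierSeries_mul_exp {a : ℤ → ℂ} (ha : Summable fun n => ‖a n‖) {f : ℝ → ℂ}
    (hf : ∀ θ : ℝ, HasSum (fun n : ℤ => a n * Complex.exp (Complex.I * n * θ)) (f θ)) (n : ℤ) :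
    ∫ θ in (0 : ℝ)..(2 * Real.pi), f θ * Complex.exp (-(Complex.I * n * θ)) =
      2 * Real.pi * a n := by
  have hexp : ∀ (m : ℤ) (θ : ℝ), a m * Complex.exp (Complex.I * m * θ) *
      Complex.exp (-(Complex.I * n * θ)) = a m * Complex.exp (Complex.I * (m - n : ℤ) * θ) :=
    fun m θ => by
      rw [mul_assoc, ← Complex.exp_add]
      push_cast
      ring_nf
  have key := intervalIntegral.hasSum_integral_of_dominated_convergence (μ := volume)
    (a := 0) (b := 2 * Real.pi)
    (F := fun (m : ℤ) (θ : ℝ) => a m * Complex.exp (Complex.I * (m - n : ℤ) * θ))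
    (f := fun θ : ℝ => f θ * Complex.exp (-(Complex.I * n * θ)))
    (fun m _ => ‖a m‖)
    (fun m => (by fun_prop : Continuous fun θ : ℝ =>
      a m * Complex.exp (Complex.I * (m - n : ℤ) * θ)).aestronglyMeasurable)
    (fun m => Eventually.of_forall fun θ _ => le_of_eq (by
      rw [norm_mul, Complex.norm_exp]
      simp))
    (Eventually.of_forall fun _ _ => ha)
    intervalIntegrable_const
    (Eventually.of_forall fun θ _ => by
      simp only [← hexp]
      exact (hf θ).mul_right _)
  refine key.unique ((hasSum_ite_eq n (2 * Real.pi * a n)).congr_fun fun m => ?_)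
  rw [intervalIntegral.integral_const_mul, integral_exp_I_mul_int]
  simp only [sub_eq_zero]
  split_ifs with h
  · rw [h, mul_comm]
  · rw [mul_zero]

/-! ### Discrete Fourier sums -/

theorem isPrimitiveRoot_omega {N : ℕ} (hN : N ≠ 0) : IsPrimitiveRoot (omega N) N :=
  Complex.isPrimitiveRoot_exp N hN

theorem omega_ne_zero (N : ℕ) : omega N ≠ 0 := Complex.exp_ne_zero _

theorem omega_zpow (N : ℕ) (n : ℤ) :
    omega N ^ n = Complex.exp (((2 * Real.pi * n / N : ℝ) : ℂ) * Complex.I) := by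
  rw [omega, ← Complex.exp_int_mul]
  push_cast
  ring_nf

theorem sum_omega_zpow_pow {N : ℕ} (hN : N ≠ 0) (n : ℤ) :
    ∑ l ∈ Finset.range N, (omega N ^ n) ^ l = if (N : ℤ) ∣ n then (N : ℂ) else 0 := by
  have hω := isPrimitiveRoot_omega hN
  split_ifs with h
  · rw [(hω.zpow_eq_one_iff_dvd n).2 h]
    simp
  · have h1 : omega N ^ n ≠ 1 := fun e => h ((hω.zpow_eq_one_iff_dvd n).1 e)
    rw [geom_sum_eq h1, ← zpow_natCast, ← zpow_mul, mul_comm n, zpow_mul, zpow_natCast, hω.pow_eq_one,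
      one_zpow, sub_self, zero_div]

/-- Sampling at `2πl/N` turns the exponentials into powers of `ω`; the sum over `l` keeps only `n ≡
-m` modulo `N`. -/
theorem hasSum_aliasing {a : ℤ → ℂ} {f : ℝ → ℂ}
    (hf : ∀ θ : ℝ, HasSum (fun n : ℤ => a n * Complex.exp (Complex.I * n * θ)) (f θ))
    {N : ℕ} (hN : N ≠ 0) (m : ℕ) :
    HasSum (fun n : ℤ => N * (a n * if (N : ℤ) ∣ n + m then 1 else 0))
      (∑ l ∈ Finset.range N, f (2 * Real.pi * l / N) * (omega N ^ m) ^ l) := by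
  have h := hasSum_sum (s := Finset.range N) fun l _ =>
    (hf (2 * Real.pi * l / N)).mul_right ((omega N ^ m) ^ l)
  refine h.congr_fun fun n => ?_
  have hterm : ∀ l : ℕ, a n * Complex.exp (Complex.I * n * (2 * Real.pi * l / N : ℝ)) *
      (omega N ^ m) ^ l = a n * (omega N ^ (n + m)) ^ l := fun l => by
    rw [zpow_add₀ (omega_ne_zero N), mul_pow, zpow_natCast, omega_zpow, ← Complex.exp_nat_mul,
      mul_assoc]
    push_cast
    ring_nf
  simp only [hterm, ← Finset.mul_sum]
  rw [sum_omega_zpow_pow hN]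
  split_ifs <;> ring

/-- The surviving indices are `-(nN + m)`; evenness of `a` removes the sign. -/
theorem hasSum_arithmeticProgression {a : ℤ → ℂ} (heven : ∀ n, a (-n) = a n) {N : ℕ} (hN : N ≠ 0)
    (m : ℕ) {s : ℂ} (h : HasSum (fun n : ℤ => N * (a n * if (N : ℤ) ∣ n + m then 1 else 0)) s) :
    HasSum (fun n : ℤ => N * a (n * N + m)) s := by
  have hN' : (N : ℤ) ≠ 0 := by exact_mod_cast hN
  have hinj : Function.Injective fun n : ℤ => -(n * N + m) := fun i j hij => by
    have : i * (N : ℤ) = j * N := by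
      simp only at hij
      linarith
    exact mul_right_cancel₀ hN' this
  rw [← hinj.hasSum_iff] at h
  · refine h.congr_fun fun n => ?_
    have hd : (N : ℤ) ∣ -(n * N + m) + m := ⟨-n, by ring⟩
    simp [Function.comp, heven, -neg_add_rev, hd]
  · intro n hn
    have hnd : ¬ (N : ℤ) ∣ n + m := fun ⟨k, hk⟩ => hn ⟨-k, by
      simp only
      linear_combination -hk⟩
    simp [hnd]

/-! ### Cyclic matrices -/

theorem sum_range_periodic_shift {P : ℤ → ℂ} {N : ℕ} (hP : Function.Periodic P N) (k : ℕ) :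
    ∑ j ∈ Finset.range N, P (j - k) = ∑ j ∈ Finset.range N, P j := by
  induction k with
  | zero => simp
  | succ k ih =>
    have h1 := Finset.sum_range_succ (fun j : ℕ => P (j - (k + 1 : ℕ))) N
    have h2 := Finset.sum_range_succ' (fun j : ℕ => P (j - (k + 1 : ℕ))) N
    have h3 : P (N - (k + 1 : ℕ)) = P ((0 : ℕ) - (k + 1 : ℕ)) := by
      rw [← hP ((0 : ℕ) - (k + 1 : ℕ))]
      push_cast
      ring_nf
    have h4 : ∀ j : ℕ, ((j + 1 : ℕ) : ℤ) - (k + 1 : ℕ) = j - k := fun j => by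
      push_cast
      ring
    simp only [h4] at h2
    rw [h1, h3, add_left_inj] at h2
    rw [h2, ih]

/-- The vectors `(ω^{mk})_k` are eigenvectors, and distinct nodes make their Vandermonde matrix
invertible. Conjugation to a diagonal matrix gives the multiplicities. -/
theorem charpoly_cyclic {N : ℕ} (hN : N ≠ 0) {h : ℤ → ℂ} (hper : Function.Periodic h N)
    {G : Matrix (Fin N) (Fin N) ℂ} (hG : ∀ k j : Fin N, G k j = h ((j : ℕ) - (k : ℕ))) :
    G.charpoly = ∏ m ∈ Finset.range N,
      (Polynomial.X - Polynomial.C (∑ l ∈ Finset.range N, h l * (omega N ^ m) ^ l)) := by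
  have hω := isPrimitiveRoot_omega hN
  have h0 := omega_ne_zero N
  set d : Fin N → ℂ := fun m => ∑ l ∈ Finset.range N, h l * (omega N ^ (m : ℕ)) ^ l with hd
  set V : Matrix (Fin N) (Fin N) ℂ :=
    (Matrix.vandermonde fun m : Fin N => omega N ^ (m : ℕ)).transpose with hV
  have hdet : IsUnit V.det := by
    rw [hV, Matrix.det_transpose, isUnit_iff_ne_zero, Matrix.det_vandermonde_ne_zero_iff]
    intro i j hij
    exact Fin.ext (hω.pow_inj i.2 j.2 hij)
  have hGV : G * V = V * Matrix.diagonal d := by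
    ext k m
    rw [Matrix.mul_diagonal, Matrix.mul_apply]
    simp only [hV, Matrix.transpose_apply, Matrix.vandermonde_apply, hG]
    -- After `ω^{mk}` is factored out, row `k` sums a function of `j - k` of period `N`, so the
    -- remaining sum is independent of `k`.
    have hP : Function.Periodic (fun z : ℤ => h z * (omega N ^ (m : ℕ)) ^ z) N := fun z => by
      simp only
      rw [hper z, zpow_add₀ (pow_ne_zero _ h0), zpow_natCast, ← pow_mul, mul_comm (m : ℕ) N, pow_mul,
        hω.pow_eq_one, one_pow, mul_one]
    have hs := sum_range_periodic_shift hP k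
    simp only [zpow_natCast] at hs
    rw [hd]
    simp only
    rw [← hs, Finset.mul_sum, ← Fin.sum_univ_eq_sum_range
      (fun j : ℕ => (omega N ^ (m : ℕ)) ^ (k : ℕ) * (h ((j : ℤ) - (k : ℕ)) *
        (omega N ^ (m : ℕ)) ^ ((j : ℤ) - (k : ℕ)))) N]
    refine Finset.sum_congr rfl fun j _ => ?_
    rw [zpow_sub₀ (pow_ne_zero _ h0), zpow_natCast, zpow_natCast]
    field_simp
  have hGeq : G = V * Matrix.diagonal d * V⁻¹ := by
    rw [← hGV, Matrix.mul_assoc, Matrix.mul_nonsing_inv _ hdet, Matrix.mul_one]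
  obtain ⟨U, hU⟩ := (Matrix.isUnit_iff_isUnit_det V).2 hdet
  rw [hGeq, ← hU, Matrix.charpoly_units_conj, Matrix.charpoly_diagonal]
  exact Fin.prod_univ_eq_prod_range (fun m => Polynomial.X - Polynomial.C
    (∑ l ∈ Finset.range N, h l * (omega N ^ m) ^ l)) N

/-! ### The collocation matrix -/

/-- Rotating both points together changes nothing, so only the angle difference matters. -/
theorem normalDerivK_polar {α R ρ : ℝ} (hR : 0 < R) (A B : ℝ) :
    normalDerivK α (R * Complex.exp (A * Complex.I)) (ρ * Complex.exp (B * Complex.I)) =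
      kernel α R ρ (A - B) := by
  have hx : ‖(R : ℂ) * Complex.exp (A * Complex.I)‖ = R := by
    rw [norm_mul, Complex.norm_exp_ofReal_mul_I, mul_one, Complex.norm_real, Real.norm_of_nonneg hR.le]
  have hd : ‖(R : ℂ) * Complex.exp (A * Complex.I) - ρ * Complex.exp (B * Complex.I)‖ =
      pointDist R ρ (A - B) := by
    have : (R : ℂ) * Complex.exp (A * Complex.I) - ρ * Complex.exp (B * Complex.I) =
        Complex.exp (A * Complex.I) *
          (R - ρ * Complex.exp (-(Complex.I * ((A - B : ℝ) : ℂ)))) := by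
      rw [mul_sub, mul_left_comm, ← Complex.exp_add]
      push_cast
      ring_nf
    rw [this, norm_mul, Complex.norm_exp_ofReal_mul_I, one_mul, pointDist]
  have hre : ((R : ℂ) * Complex.exp (A * Complex.I) / (R : ℂ) *
      (starRingEnd ℂ) (ρ * Complex.exp (B * Complex.I))).re = ρ * Real.cos (A - B) := by
    have hR' : (R : ℂ) ≠ 0 := by exact_mod_cast hR.ne'
    rw [mul_div_cancel_left₀ _ hR', map_mul, Complex.conj_ofReal, ← Complex.exp_conj, map_mul,
      Complex.conj_ofReal, Complex.conj_I, mul_left_comm, ← Complex.exp_add, Complex.re_ofReal_mul]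
    have : (A : ℂ) * Complex.I + B * -Complex.I = ((A - B : ℝ) : ℂ) * Complex.I := by
      push_cast
      ring
    rw [this, Complex.exp_ofReal_mul_I_re]
  rw [normalDerivK, hx, hd, hre, kernel]

theorem kernel_periodic (α R ρ : ℝ) : Function.Periodic (kernel α R ρ) (2 * Real.pi) := fun θ => by
  have hd : pointDist R ρ (θ + 2 * Real.pi) = pointDist R ρ θ := by
    rw [pointDist, pointDist]
    have : -(Complex.I * ((θ + 2 * Real.pi : ℝ) : ℂ)) =
        -(Complex.I * θ) - 2 * Real.pi * Complex.I := by
      push_cast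
      ring
    rw [this, Complex.exp_periodic.sub_eq]
  rw [kernel, hd, Real.cos_add_two_pi, kernel]

theorem matrixG_apply {α R ρ : ℝ} (hR : 0 < R) (N : ℕ) (k j : Fin N) :
    matrixG α R ρ N k j =
      (kernel α R ρ (2 * Real.pi * (((j : ℕ) - (k : ℕ) : ℤ) : ℝ) / N) : ℂ) := by
  rw [matrixG, Matrix.of_apply, collocationPoint, chargePoint, ← zpow_natCast, ← zpow_natCast,
    omega_zpow, omega_zpow, normalDerivK_polar hR]
  -- The offsets in `j + 1` and `k + 1` cancel in the angle difference.
  congr 2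
  push_cast
  ring

theorem charpoly_matrixG {α R ρ : ℝ} (hR : 0 < R) {N : ℕ} (hN : N ≠ 0) :
    (matrixG α R ρ N).charpoly = ∏ m ∈ Finset.range N,
      (Polynomial.X - Polynomial.C (eigenPoly α R ρ N (omega N ^ m))) := by
  have hN' : (N : ℝ) ≠ 0 := by exact_mod_cast hN
  have hper : Function.Periodic
      (fun z : ℤ => (kernel α R ρ (2 * Real.pi * (z : ℝ) / N) : ℂ)) N := fun z => by
    have : 2 * Real.pi * ((z + N : ℤ) : ℝ) / N = 2 * Real.pi * z / N + 2 * Real.pi := by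
      push_cast
      field_simp
    simp only
    rw [this, kernel_periodic]
  rw [charpoly_cyclic hN hper (matrixG_apply hR N)]
  simp only [eigenPoly, Int.cast_natCast]

end MFS

theorem mainTheorem3 (α R ρ : ℝ) (hα : 0 < α) (hR : 0 < R) (hρ : R < ρ) :
    -- the series defining each coefficient converges
    (∀ n : ℤ, Summable (MFS.tildeTerm α R ρ n)) ∧
    -- the numbers `Ã_n / R` are the Fourier coefficients of `c`
    (∀ n : ℤ, 1 / (2 * (Real.pi : ℂ)) *
        ∫ θ in (0 : ℝ)..(2 * Real.pi),
          (MFS.kernel α R ρ θ : ℂ) * Complex.exp (-(Complex.I * (n : ℂ) * (θ : ℂ)))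
      = (MFS.tildeA α R ρ n : ℂ) / (R : ℂ)) ∧
    -- and the Fourier series converges (absolutely) to `c` at every point
    (∀ θ : ℝ, HasSum
      (fun n : ℤ => 1 / (R : ℂ) *
        ((MFS.tildeA α R ρ n : ℂ) * Complex.exp (Complex.I * (n : ℂ) * (θ : ℂ))))
      (MFS.kernel α R ρ θ : ℂ)) ∧
    (∀ N : ℕ, 1 ≤ N →
      -- the eigenvalues of `G`, with multiplicity, are `f(ω^m)`, `0 ≤ m < N`
      (MFS.matrixG α R ρ N).charpoly
        = ∏ m ∈ Finset.range N,
            (Polynomial.X - Polynomial.C (MFS.eigenPoly α R ρ N (MFS.omega N ^ m))) ∧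
      -- and they are given by the aliased sums
      ∀ m : ℕ, m < N →
        HasSum
          (fun n : ℤ => (N : ℂ) / (R : ℂ) *
            ((MFS.tildeA α R ρ n : ℂ) * (if (N : ℤ) ∣ n + (m : ℤ) then 1 else 0)))
          (MFS.eigenPoly α R ρ N (MFS.omega N ^ m)) ∧
        HasSum
          (fun n : ℤ => (N : ℂ) / (R : ℂ) *
            (MFS.tildeA α R ρ (n * (N : ℤ) + (m : ℤ)) : ℂ))
          (MFS.eigenPoly α R ρ N (MFS.omega N ^ m))) := by 
  refine ⟨fun n => (MFS.hasSum_tildeTerm hα hR hρ n).summable, fun n => ?_, fun θ => ?_,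
    fun N hN => ?_⟩
  · rw [MFS.integral_fourierSeries_mul_exp (MFS.summable_norm_tildeA_div hα hR hρ)
      (MFS.hasSum_kernel hα hR hρ) n, ← mul_assoc, one_div,
      inv_mul_cancel₀ (mul_ne_zero two_ne_zero (Complex.ofReal_ne_zero.2 Real.pi_ne_zero)), one_mul]
  · refine (MFS.hasSum_kernel hα hR hρ θ).congr_fun fun n => ?_
    ring
  · have hN0 : N ≠ 0 := Nat.one_le_iff_ne_zero.1 hN
    refine ⟨MFS.charpoly_matrixG hR hN0, fun m _ => ?_⟩
    have h : HasSum _ (MFS.eigenPoly α R ρ N (MFS.omega N ^ m)) :=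
      MFS.hasSum_aliasing (MFS.hasSum_kernel hα hR hρ) hN0 m
    refine ⟨h.congr_fun fun n => by ring, ?_⟩
    have heven : ∀ n : ℤ, (MFS.tildeA α R ρ (-n) : ℂ) / R = (MFS.tildeA α R ρ n : ℂ) / R :=
      fun n => by rw [MFS.tildeA_neg hα hR hρ]
    refine (MFS.hasSum_arithmeticProgression heven hN0 m h).congr_fun fun n => ?_
    ring
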